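/- Let $K$ be a field, let $A=K[a_1,\dots,a_m]$ and $P=A[x_1,\dots,x_k]$ be polynomial rings, and put $n=m+k$. Grade $P$ by a tuple of weights $W=(w_1,\dots,w_k)\in\mathbb{Z}^k$ with $w_j>0$ for all $j$, where $\deg(x_j)=w_j$ and $A$ has degree $0$. Let $I\subseteq P$ be a $W$-homogeneous ideal with $I\cap A=\{0\}$, so that $R=P/I$ is a positive $A$-algebra (then $I\subseteq\langle x_1,\dots,x_k\rangle$), let $d=\dim(R)$, and let $\Theta:\operatorname{Spec}(R)\to\operatorname{Spec}(A)=\mathbb{A}^m_K$ be the canonical morphism. Let $Z_R\subseteq\operatorname{Spec}(R)$ be the zero section, i.e. the image of $\mathbb{A}^m_K\to\operatorname{Spec}(R)$ induced by $R\to P/\langle x_1,\dots,x_k\rangle\cong A$. For $\Gamma=(\gamma_1,\dots,\gamma_m)\in K^m$ let $\mathfrak{M}_{\Gamma_0}\subset P$ be the maximal ideal of the point $\Gamma_0=(\gamma_1,\dots,\gamma_m,0,\dots,0)\in K^n$, let $\operatorname{Cot}_{\mathfrak{M}_{\Gamma_0}}(R)=\mathfrak{m}/\mathfrak{m}^2$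 with $\mathfrak{m}=\mathfrak{M}_{\Gamma_0}/I\subset R$, let $R_{\Gamma_0}=R_{\mathfrak{m}}$, and let $d_{\Gamma_0}=\dim(R_{\Gamma_0})$. For a local ring $(S,\mathfrak{n})$ put $\operatorname{ecod}(S)=\dim_{S/\mathfrak{n}}(\mathfrak{n}/\mathfrak{n}^2)-\dim(S)$, and let $$\operatorname{Sing}_0(\Theta)=\{\Gamma\in K^m\mid \operatorname{ecod}(R_{\Gamma_0})>0\}$$ be the set of zero section singularities of $\Theta$. Let $G=(g_1,\dots,g_s)$ be a tuple of $W$-homogeneous polynomials which generate $I$. Let $\mathcal{L}_A(G)=(g_{ij})\in\operatorname{Mat}_{s,k}(A)$, where $g_{ij}\in A$ is the coefficient of $x_j$ in $g_i$ viewed as a polynomial in $x_1,\dots,x_k$ over $A$, and let $\mathcal{L}_K(G_\Gamma)=(g_{ij}(\Gamma))\in\operatorname{Mat}_{s,k}(K)$ for $\Gamma\in K^m$. Let $J_{n-d}\subseteq A$ be the ideal generated by all minors of size $n-d$ of $\mathcal{L}_A(G)$, and let $\mathcal{Z}(J_{n-d})\subseteq K^m$ be its set of zeros. Then: (a) For every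 $\Gamma\in K^m$ we have $\operatorname{rk}(\mathcal{L}_K(G_\Gamma)) = n-\dim_K(\operatorname{Cot}_{\mathfrak{M}_{\Gamma_0}}(R))\le n-d_{\Gamma_0}$. (b) $\operatorname{Sing}_0(\Theta)=\{\Gamma\in K^m\mid \operatorname{rk}(\mathcal{L}_K(G_\Gamma))<n-d_{\Gamma_0}\}$. (c) If $\operatorname{rk}(\mathcal{L}_A(G))<n-d$, then $\operatorname{Sing}_0(\Theta)=K^m$, and the zero section $Z_R$ is contained in the singular locus of $\operatorname{Spec}(R)$, i.e. in the set of primes $\mathfrak{p}$ such that $R_{\mathfrak{p}}$ is not a regular local ring. (d) If $\operatorname{rk}(\mathcal{L}_A(G))=n-d$, then $\mathcal{Z}(J_{n-d})\subseteq\operatorname{Sing}_0(\Theta)$. (e) If $\operatorname{Spec}(R)$ is equidimensional (all its irreducible components have the same dimension), then $\operatorname{rk}(\mathcal{L}_A(G))\le n-d$ and $\operatorname{Sing}_0(\Theta)=\mathcal{Z}(J_{n-d})$. -/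

import Mathlib

set_option maxSynthPendingDepth 3

open MvPolynomial

noncomputable section

namespace PositiveAlgebra

variable {K : Type*} [Field K] {m k : ℕ}

/-- The ring `P = A[x₁, …, x_k]` over `A = K[a₁, …, a_m]`. For weights `W` on the `x_j`, the
`W`-grading of `P` over `A` is the one in which `A` sits in degree zero. -/
abbrev PolyRing (K : Type*) [Field K] (m k : ℕ) : Type _ :=
  MvPolynomial (Fin k) (MvPolynomial (Fin m) K)

/-- `R = P / I` is a positive `A`-algebra: the weights are positive, the ideal `I` is
`W`-homogeneous, and `I ∩ A = {0}`. -/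
structure IsPositiveAlgebra (W : Fin k → ℤ) (I : Ideal (PolyRing K m k)) : Prop where
  weight_pos : ∀ j, 0 < W j
  homogeneous : letI := weightedGradedAlgebra (MvPolynomial (Fin m) K) W
    I.IsHomogeneous (weightedHomogeneousSubmodule (MvPolynomial (Fin m) K) W)
  inter_base : I.comap (C : MvPolynomial (Fin m) K →+* PolyRing K m k) = ⊥

/-- Evaluation at the zero point `Γ₀ = (γ₁, …, γ_m, 0, …, 0)`. -/
def evalZeroPoint (Γ : Fin m → K) : PolyRing K m k →+* K :=
  eval₂Hom (eval Γ) (fun _ : Fin k => (0 : K))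

/-- The maximal ideal `𝔐_{Γ₀}` of `P` corresponding to the zero point over `Γ`. -/
def zeroMaxIdeal (k : ℕ) (Γ : Fin m → K) : Ideal (PolyRing K m k) :=
  RingHom.ker (evalZeroPoint (k := k) Γ)

variable {W : Fin k → ℤ} {I : Ideal (PolyRing K m k)}

/-- `I` is contained in `⟨x₁, …, x_k⟩`. -/
theorem IsPositiveAlgebra.constantCoeff_eq_zero (h : IsPositiveAlgebra W I)
    {f : PolyRing K m k} (hf : f ∈ I) : constantCoeff f = 0 := by
  classical
  have h0 : weightedHomogeneousComponent W 0 f ∈ I :=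
    weightedHomogeneousComponent_mem_of_mem _ W h.homogeneous hf 0
  have h1 : weightedHomogeneousComponent W 0 f = C (constantCoeff f) := by
    ext1 e
    rw [coeff_weightedHomogeneousComponent, coeff_C]
    by_cases he : 0 = e
    · subst he
      simp [constantCoeff_eq]
    · rw [if_neg he, if_neg]
      intro hw
      apply he
      rw [Finsupp.weight_apply, Finsupp.sum_fintype _ _ (by simp)] at hw
      have hnn : ∀ j ∈ Finset.univ, 0 ≤ e j • W j := fun j _ =>
        nsmul_nonneg (h.weight_pos j).le _
      rw [Finset.sum_eq_zero_iff_of_nonneg hnn] at hw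
      ext j
      have h2 := hw j (Finset.mem_univ j)
      rw [smul_eq_zero] at h2
      rcases h2 with h2 | h2
      · exact h2.symm
      · exact absurd h2 (h.weight_pos j).ne'
  rw [h1] at h0
  have h3 : constantCoeff f ∈ I.comap (C : MvPolynomial (Fin m) K →+* PolyRing K m k) := h0
  rw [h.inter_base] at h3
  simpa using h3

theorem IsPositiveAlgebra.le_zeroMaxIdeal (h : IsPositiveAlgebra W I) (Γ : Fin m → K) :
    I ≤ zeroMaxIdeal k Γ := by
  intro f hf
  have h1 : (evalZeroPoint (k := k) Γ) = (eval Γ).comp constantCoeff := by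
    ext <;> simp [evalZeroPoint]
  rw [zeroMaxIdeal, RingHom.mem_ker, h1, RingHom.comp_apply, h.constantCoeff_eq_zero hf, map_zero]

/-- The zero point `Γ₀` as a point of `Spec R`; its ideal is `𝔐_{Γ₀} / I`. -/
def zeroPoint (h : IsPositiveAlgebra W I) (Γ : Fin m → K) :
    PrimeSpectrum (PolyRing K m k ⧸ I) where
  asIdeal := (zeroMaxIdeal k Γ).map (Ideal.Quotient.mk I)
  isPrime := by
    have : (zeroMaxIdeal k Γ).IsPrime := RingHom.ker_isPrime _
    refine Ideal.map_isPrime_of_surjective Ideal.Quotient.mk_surjective ?_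
    rw [Ideal.mk_ker]
    exact h.le_zeroMaxIdeal Γ

/-- The local ring `R_{Γ₀}` of the zero point over `Γ`. -/
abbrev ZeroLocalRing (h : IsPositiveAlgebra W I) (Γ : Fin m → K) : Type _ :=
  Localization.AtPrime (zeroPoint h Γ).asIdeal

/-- The Krull dimension as a natural number, for nonzero rings of finite Krull dimension (the
local rings below are Noetherian, hence of this kind). -/
def krullDim (S : Type*) [CommRing S] : ℕ :=
  ((ringKrullDim S).unbotD 0).toNat

/-- The embedding dimension `dim (𝔪 / 𝔪²)` of a local ring. -/
def edim (S : Type*) [CommRing S] [IsLocalRing S] : ℕ :=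
  Module.finrank (IsLocalRing.ResidueField S) (IsLocalRing.CotangentSpace S)

/-- The embedding codimension of a local ring. -/
def ecod (S : Type*) [CommRing S] [IsLocalRing S] : ℤ :=
  (edim S : ℤ) - krullDim S

/-- The set `Sing₀(Θ)` of zero section singularities. -/
def singZero (h : IsPositiveAlgebra W I) : Set (Fin m → K) :=
  {Γ | 0 < ecod (ZeroLocalRing h Γ)}

/-- The epimorphism `R = P / I → P / ⟨x₁, …, x_k⟩ ≅ A`. -/
def zeroSectionHom (h : IsPositiveAlgebra W I) :
    (PolyRing K m k ⧸ I) →+* MvPolynomial (Fin m) K :=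
  Ideal.Quotient.lift I constantCoeff fun _ hf => h.constantCoeff_eq_zero hf

/-- The zero section `Z_R`, the image of `Spec A → Spec R`. -/
def zeroSection (h : IsPositiveAlgebra W I) : Set (PrimeSpectrum (PolyRing K m k ⧸ I)) :=
  Set.range (PrimeSpectrum.comap (zeroSectionHom h))

/-- The singular locus of `Spec S`: the points whose local ring is not regular. -/
def singularLocus (S : Type*) [CommRing S] : Set (PrimeSpectrum S) :=
  {p | ¬ IsRegularLocalRing (Localization.AtPrime p.asIdeal)}

/-- `Spec S` is equidimensional: all its irreducible components `Spec (S / 𝔭)`, with `𝔭` a minimal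
prime of `S`, have the dimension of `S`. -/
def IsEquidimensional (S : Type*) [CommRing S] : Prop :=
  ∀ p ∈ minimalPrimes S, ringKrullDim (S ⧸ p) = ringKrullDim S

/-- The `A`-linear coefficient matrix `𝓛_A(G)`. Its `(i, j)` entry is the coefficient in `A` of
`x_j` in `g_i`: writing `g_i = f₀ + f₁ x₁ + ⋯ + f_k x_k + g` with `f₀, …, f_k ∈ A` and
`g ∈ ⟨x₁, …, x_k⟩²`, it is `f_j`. -/
def linCoeffMatrix {s : ℕ} (G : Fin s → PolyRing K m k) :
    Matrix (Fin s) (Fin k) (MvPolynomial (Fin m) K) :=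
  Matrix.of fun i j => coeff (Finsupp.single j 1) (G i)

/-- The `K`-linear coefficient matrix `𝓛_K(G_Γ)` at the point `Γ`. -/
def linCoeffMatrixAt {s : ℕ} (G : Fin s → PolyRing K m k) (Γ : Fin m → K) :
    Matrix (Fin s) (Fin k) K :=
  (linCoeffMatrix G).map (eval Γ)

/-- The ideal generated by all minors of size `t` of a matrix. -/
def minorsIdeal {S : Type*} [CommRing S] {s k : ℕ} (M : Matrix (Fin s) (Fin k) S) (t : ℕ) :
    Ideal S :=
  Ideal.span (Set.range fun p : (Fin t ↪o Fin s) × (Fin t ↪o Fin k) =>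
    (M.submatrix p.1 p.2).det)

end PositiveAlgebra

end

open PositiveAlgebra

/-! Everything rests on one identity, `edim_add_rank`. For a prime `p` of `A`, let `z` be its point
on the zero section of `Spec R`; then the embedding dimension of `R_z` plus the rank of `𝓛_A(G)`
modulo `p` equals `ht p + k`. Indeed, `P` is regular at the corresponding prime, of dimension `ht p
+ k`, and the variables `x_j` are independent in its cotangent space. Each `g_i` has no constant
term, so it agrees with its linear part modulo the square of that prime; passing to `R` thus removes
exactly the span of the rows of the matrix.

For `p = ker (eval Γ)` the height is `m`, which gives (a) and (b) together with `dim ≤ edim`. Ranks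
drop under specialization and `dim R_z + dim A/p ≤ d`, whence (c) and (d); (c) needs all `p`, and
also `m ≤ ht p + dim A/p`. If `R` is equidimensional, the dimension formula for affine algebras
gives `d_{Γ₀} = d`, and at `p = 0` it bounds the generic rank; this is (e). -/

noncomputable section

/-! ### Ranks, minors and specialization of matrices. -/

namespace Matrix

/-- A matrix over a field of rank at least `t` has `t` linearly independent rows. -/
theorem exists_orderEmbedding_linearIndependent_row {L : Type*} [Field L] {s k t : ℕ}
    (N : Matrix (Fin s) (Fin k) L) (h : t ≤ N.rank) :
    ∃ r : Fin t ↪o Fin s, LinearIndependent L (N.submatrix r id).row := by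
  classical
  obtain ⟨J, a, ha, hspan, hli⟩ := exists_linearIndependent' L N.row
  have : Finite J := Finite.of_injective a ha
  have := Fintype.ofFinite J
  have hcard : Fintype.card J = N.rank := by
    rw [N.rank_eq_finrank_span_row, ← hspan, finrank_span_eq_card hli]
  have hT : t ≤ (Finset.univ.image a).card := by
    rwa [Finset.card_image_of_injective _ ha, Finset.card_univ, hcard]
  obtain ⟨T, hTsub, hTcard⟩ := Finset.exists_subset_card_eq hT
  refine ⟨T.orderEmbOfFin hTcard, ?_⟩
  have hmem : ∀ i, ∃ j, a j = T.orderEmbOfFin hTcard i := fun i => by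
    simpa using hTsub (T.orderEmbOfFin_mem hTcard i)
  choose b hb using hmem
  have hb' : Function.Injective b := fun i j hij =>
    (T.orderEmbOfFin hTcard).injective (by rw [← hb, ← hb, hij])
  have h1 := hli.comp b hb'
  have h2 : (N.row ∘ a) ∘ b = (N.submatrix (T.orderEmbOfFin hTcard) id).row := by
    funext i j
    simp only [Function.comp_apply, hb]
    rfl
  rwa [h2] at h1

/-- Over a field, the rank is at least `t` if and only if some minor of size `t` is nonzero. -/
theorem le_rank_iff_exists_det_ne_zero {L : Type*} [Field L] {s k t : ℕ}
    (N : Matrix (Fin s) (Fin k) L) :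
    t ≤ N.rank ↔ ∃ p : (Fin t ↪o Fin s) × (Fin t ↪o Fin k), (N.submatrix p.1 p.2).det ≠ 0 := by
  constructor
  · intro h
    obtain ⟨r, hr⟩ := N.exists_orderEmbedding_linearIndependent_row h
    have h1 : t ≤ (N.submatrix r id)ᵀ.rank := by
      rw [rank_transpose, hr.rank_matrix, Fintype.card_fin]
    -- Choosing `t` independent columns means choosing rows of the transpose of the `t` rows already
    -- found.
    obtain ⟨c, hc⟩ := exists_orderEmbedding_linearIndependent_row _ h1
    refine ⟨(r, c), ?_⟩
    rw [← det_transpose, ← isUnit_iff_ne_zero, ← isUnit_iff_isUnit_det,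
      ← linearIndependent_rows_iff_isUnit]
    exact hc
  · rintro ⟨⟨r, c⟩, h⟩
    have h1 := N.rank_submatrix_le r c
    rwa [rank_of_det_ne_zero h, Fintype.card_fin] at h1

theorem le_rank_map_iff {A L : Type*} [CommRing A] [Field L] (φ : A →+* L) {s k t : ℕ}
    (M : Matrix (Fin s) (Fin k) A) :
    t ≤ (M.map φ).rank ↔
      ∃ p : (Fin t ↪o Fin s) × (Fin t ↪o Fin k), φ (M.submatrix p.1 p.2).det ≠ 0 := by
  simp_rw [le_rank_iff_exists_det_ne_zero, submatrix_map, RingHom.map_det, RingHom.mapMatrix_apply]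

/-- The rank of `M` over a field only drops when more entries are sent to zero. -/
theorem rank_map_le_of_ker_le {A L L' : Type*} [CommRing A] [Field L] [Field L'] (φ : A →+* L)
    (ψ : A →+* L') (h : RingHom.ker φ ≤ RingHom.ker ψ) {s k : ℕ} (M : Matrix (Fin s) (Fin k) A) :
    (M.map ψ).rank ≤ (M.map φ).rank := by
  obtain ⟨p, hp⟩ := (M.le_rank_map_iff ψ).mp le_rfl
  exact (M.le_rank_map_iff φ).mpr ⟨p, fun h0 => hp (h h0)⟩

/-- The rank of a matrix over a domain is its rank over the field of fractions. -/
theorem rank_map_algebraMap_fractionRing {A : Type*} [CommRing A] [IsDomain A] {s k : ℕ}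
    (M : Matrix (Fin s) (Fin k) A) : (M.map (algebraMap A (FractionRing A))).rank = M.rank := by
  apply le_antisymm
  · obtain ⟨p, hp⟩ := (M.le_rank_map_iff _).mp (le_refl (M.map (algebraMap A (FractionRing A))).rank)
    have h0 : (M.submatrix p.1 p.2).det ≠ 0 := fun h0 => hp (by rw [h0, map_zero])
    have h1 := M.rank_submatrix_le p.1 p.2
    rwa [rank_of_det_ne_zero h0, Fintype.card_fin] at h1
  · let L := FractionRing A
    let e : (Fin s → A) →ₗ[A] (Fin s → L) := (Algebra.linearMap A L).compLeft (Fin s)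
    have he : Function.Injective e := fun x y hxy => by
      ext i
      exact IsFractionRing.injective A L (congrFun hxy i)
    -- An independent family in the column module over `A` stays independent over the fraction
    -- field, where it lies in the column space.
    obtain ⟨v, hv⟩ := exists_linearIndependent_of_le_finrank
      (le_refl (Module.finrank A (LinearMap.range M.mulVecLin)))
    have h1 : LinearIndependent A (e ∘ Subtype.val ∘ v) := by
      have h2 := (hv.map' (LinearMap.range M.mulVecLin).subtype (Submodule.ker_subtype _))
      exact h2.map' e (LinearMap.ker_eq_bot.mpr he)
    rw [LinearIndependent.iff_fractionRing A L] at h1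
    have h3 : Set.range (e ∘ Subtype.val ∘ v) ⊆
        LinearMap.range (M.map (algebraMap A L)).mulVecLin := by
      rintro _ ⟨i, rfl⟩
      obtain ⟨w, hw⟩ := (v i).2
      refine ⟨fun j => algebraMap A L (w j), ?_⟩
      simp only [Function.comp_apply, ← hw]
      ext l
      simp [e, mulVec, dotProduct]
    have h4 := finrank_span_eq_card h1
    rw [Fintype.card_fin] at h4
    exact h4.symm.le.trans (Submodule.finrank_mono (Submodule.span_le.mpr h3))

/-- The map to the fraction field has the smallest possible kernel, so it realizes the largest rank.
-/
theorem rank_map_le_rank {A L : Type*} [CommRing A] [IsDomain A] [Field L]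
    (ψ : A →+* L) {s k : ℕ} (M : Matrix (Fin s) (Fin k) A) : (M.map ψ).rank ≤ M.rank := by
  rw [← M.rank_map_algebraMap_fractionRing]
  refine rank_map_le_of_ker_le _ _ ?_ M
  rw [(RingHom.injective_iff_ker_eq_bot _).mp (IsFractionRing.injective A (FractionRing A))]
  exact bot_le

end Matrix

namespace PositiveAlgebra

/-- The zeros of the ideal of `t`-minors are the points where the rank is less than `t`. -/
theorem mem_zeroLocus_minorsIdeal {K : Type*} [Field K] {m s k t : ℕ}
    (M : Matrix (Fin s) (Fin k) (MvPolynomial (Fin m) K)) (Γ : Fin m → K) :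
    Γ ∈ zeroLocus K (minorsIdeal M t) ↔ (M.map (eval Γ)).rank < t := by
  rw [← not_le, Matrix.le_rank_map_iff, minorsIdeal, mem_zeroLocus_iff]
  constructor
  · rintro h ⟨p, hp⟩
    refine hp ?_
    simpa [coe_aeval_eq_eval] using h _ (Ideal.subset_span ⟨p, rfl⟩)
  · intro h f hf
    have : Ideal.span (Set.range fun p : (Fin t ↪o Fin s) × (Fin t ↪o Fin k) =>
        (M.submatrix p.1 p.2).det) ≤ RingHom.ker (eval Γ) := by
      rw [Ideal.span_le]
      rintro _ ⟨p, rfl⟩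
      by_contra hp
      exact h ⟨p, hp⟩
    simpa [coe_aeval_eq_eval] using this hf

end PositiveAlgebra

/-! ### Dimension theory of integral extensions and affine algebras. -/

/-- Incomparability: strict chains contract to strict chains. -/
theorem ringKrullDim_le_of_isIntegral (B S : Type*) [CommRing B] [CommRing S] [Algebra B S]
    [Algebra.IsIntegral B S] : ringKrullDim S ≤ ringKrullDim B :=
  Order.krullDim_le_of_strictMono (PrimeSpectrum.comap (algebraMap B S)) fun _ _ h =>
    Ideal.IsIntegral.comap_lt_comap h

/-- Lying over lifts the bottom of a chain, going up the rest. -/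
theorem ringKrullDim_le_of_isIntegral_of_injective (B S : Type*) [CommRing B] [CommRing S]
    [IsDomain S] [Algebra B S] [Algebra.IsIntegral B S] [FaithfulSMul B S] :
    ringKrullDim B ≤ ringKrullDim S := by
  rw [ringKrullDim, Order.krullDim]
  refine iSup_le fun l => ?_
  obtain ⟨Q, hQ, hQl⟩ := Ideal.exists_ideal_over_prime_of_isIntegral_of_isDomain (S := S)
    l.head.asIdeal (by
      rw [(RingHom.injective_iff_ker_eq_bot _).mp (FaithfulSMul.algebraMap_injective B S)]
      exact bot_le)
  have : Q.LiesOver l.head.asIdeal := ⟨hQl.symm⟩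
  obtain ⟨L, hL, -⟩ := Ideal.exists_ltSeries_of_hasGoingUp l Q
  rw [← hL]
  exact le_iSup (fun L : LTSeries (PrimeSpectrum S) => (L.length : WithBot ℕ∞)) L

namespace Ideal

/-- A longest chain below `P / Q` pulls back to primes containing `Q`, and `⊥` can be added
underneath. -/
theorem height_add_one_le_of_quotient {S : Type*} [CommRing S] [IsDomain S] [IsNoetherianRing S]
    (Q P : Ideal S) [Q.IsPrime] [P.IsPrime] (hQ : Q ≠ ⊥) (hQP : Q ≤ P)
    [(P.map (Ideal.Quotient.mk Q)).IsPrime] :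
    (P.map (Ideal.Quotient.mk Q)).height + 1 ≤ P.height := by
  obtain ⟨l, hl, hlen⟩ := (P.map (Ideal.Quotient.mk Q)).exists_ltSeries_length_eq_height
  let l' : LTSeries (PrimeSpectrum S) := l.map (PrimeSpectrum.comap (Ideal.Quotient.mk Q))
    (RingHom.strictMono_comap_of_surjective Ideal.Quotient.mk_surjective)
  have hlt : (⟨⊥, Ideal.isPrime_bot⟩ : PrimeSpectrum S) < l'.head := by
    rw [← PrimeSpectrum.asIdeal_lt_asIdeal]
    refine (bot_lt_iff_ne_bot.mpr hQ).trans_le ?_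
    simp only [l', LTSeries.head_map, PrimeSpectrum.comap_asIdeal]
    exact Ideal.mk_ker.symm.le.trans (Ideal.comap_mono bot_le)
  have hlast : (l'.cons _ hlt).last = ⟨P, inferInstance⟩ := by
    ext1
    simp only [RelSeries.last_cons, l', LTSeries.last_map, hl, PrimeSpectrum.comap_asIdeal]
    rw [Ideal.comap_map_of_surjective' _ Ideal.Quotient.mk_surjective, Ideal.mk_ker,
      sup_eq_left.mpr hQP]
  rw [(⟨P, inferInstance⟩ : PrimeSpectrum S).height_eq_orderHeight, ← hlen]
  have := Order.length_le_height (p := l'.cons _ hlt) (x := ⟨P, inferInstance⟩) hlast.le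
  simpa [l'] using this

/-- Induction on the number of variables: over a Jacobson ring a maximal ideal of the polynomial
ring contracts to a maximal ideal, and the last variable contributes one to the height. -/
theorem height_eq_of_isMaximal_mvPolynomial (K : Type*) [Field K] (n : ℕ)
    (M : Ideal (MvPolynomial (Fin n) K)) [hM : M.IsMaximal] : M.height = n := by
  induction n with
  | zero =>
    have h := Ideal.height_le_ringKrullDim_of_ne_top hM.ne_top
    rw [MvPolynomial.ringKrullDim_of_isNoetherianRing, ringKrullDim_eq_zero_of_field] at h
    simpa using h
  | succ n ih =>
    let e := (finSuccEquiv K n).toRingEquiv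
    have h1 : (M.map e).IsMaximal := Ideal.map_isMaximal_of_equiv e
    have h2 : ((M.map e).under (MvPolynomial (Fin n) K)).IsMaximal :=
      Polynomial.isMaximal_comap_C_of_isJacobsonRing _
    have h3 : (M.map e).LiesOver ((M.map e).under (MvPolynomial (Fin n) K)) := ⟨rfl⟩
    rw [← RingEquiv.height_map e M, Polynomial.height_eq_height_add_one
      ((M.map e).under (MvPolynomial (Fin n) K)) (M.map e), ih]
    simp

/-- Noether normalization reduces this to a polynomial ring: by going down the contracted prime
still has height one, so it is principal there, and integrality carries the inequality back. -/
theorem ringKrullDim_le_of_height_eq_one (K : Type*) {S : Type*} [Field K] [CommRing S] [IsDomain S]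
    [Algebra K S] [Algebra.FiniteType K S] (P : Ideal S) [P.IsPrime] (hP : P.height = 1) :
    ringKrullDim S ≤ ringKrullDim (S ⧸ P) + 1 := by
  have : IsNoetherianRing S := Algebra.FiniteType.isNoetherianRing K S
  obtain ⟨n, g, hg, hfin⟩ := exists_finite_inj_algHom_of_fg K S
  algebraize [g.toRingHom]
  have : Module.Finite (MvPolynomial (Fin n) K) S := hfin
  have : FaithfulSMul (MvPolynomial (Fin n) K) S := (faithfulSMul_iff_algebraMap_injective _ _).mpr hg
  set p := P.under (MvPolynomial (Fin n) K) with hp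
  have hp1 : p.height ≤ 1 := by
    rw [← hP, Ideal.height_eq_height_add_of_liesOver_of_hasGoingDown p P]
    exact le_self_add
  have hp0 : p ≠ ⊥ := Ideal.IsIntegral.comap_ne_bot _ fun h => by simp [h] at hP
  have hp1' : p.height = 1 := le_antisymm hp1 (Order.one_le_iff_ne_zero.mpr fun h =>
    hp0 (Ideal.height_eq_zero_iff_eq_bot.mp h))
  obtain ⟨f, hfp, hf⟩ := Ideal.IsPrime.exists_mem_prime_of_ne_bot (inferInstanceAs p.IsPrime) hp0
  have hpf := Ideal.eq_span_singleton_of_height_eq_one hp1' hfp hf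
  have h1 : ringKrullDim (MvPolynomial (Fin n) K) ≤
      ringKrullDim (MvPolynomial (Fin n) K ⧸ p) + 1 := by
    -- Every maximal ideal has height `n`, so bounding the height of one that contains `f` bounds
    -- the whole dimension.
    obtain ⟨M, hM, hpM⟩ := Ideal.exists_le_maximal p (Ideal.IsPrime.ne_top inferInstance)
    have h := Ideal.height_le_ringKrullDim_quotient_add_one (hpM hfp)
    rw [height_eq_of_isMaximal_mvPolynomial, ← hpf] at h
    simpa [ringKrullDim_eq_zero_of_field] using h
  calc ringKrullDim S ≤ ringKrullDim (MvPolynomial (Fin n) K) := ringKrullDim_le_of_isIntegral _ _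
    _ ≤ _ := h1
    _ ≤ _ := by
      gcongr
      exact ringKrullDim_le_of_isIntegral_of_injective _ _

/-- The dimension inequality `dim S ≤ ht P + dim (S / P)` for a prime `P` of an affine domain. -/
theorem ringKrullDim_le_height_add_quotient (K : Type*) {S : Type*} [Field K] [CommRing S]
    [IsDomain S] [Algebra K S] [Algebra.FiniteType K S] (P : Ideal S) [P.IsPrime] :
    ringKrullDim S ≤ P.height + ringKrullDim (S ⧸ P) := by
  have hN : IsNoetherianRing S := Algebra.FiniteType.isNoetherianRing K S
  obtain ⟨n, hn⟩ := ENat.ne_top_iff_exists.mp (Ideal.height_ne_top_of_isPrime (I := P))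
  -- Induction on `ht P`: a minimal prime `Q` over a nonzero element of `P` has height one, and `P /
  -- Q` has smaller height in `S / Q`.
  induction n using Nat.strong_induction_on generalizing S with
  | _ n ih =>
  by_cases hP : P = ⊥
  · subst hP
    rw [ringKrullDim_eq_of_ringEquiv (RingEquiv.quotientBot S)]
    simp
  obtain ⟨x, hx, hx0⟩ := Submodule.exists_mem_ne_zero_of_ne_bot hP
  obtain ⟨Q, hQ, hQP⟩ := Ideal.exists_minimalPrimes_le
    ((Ideal.span_singleton_le_iff_mem P).mpr hx)
  have : Q.IsPrime := hQ.1.1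
  have hxQ : x ∈ Q := (Ideal.span_singleton_le_iff_mem Q).mp hQ.1.2
  have hQ0 : Q ≠ ⊥ := fun h => hx0 (by simpa [h] using hxQ)
  have hQ1 : Q.height = 1 := le_antisymm
    (Ideal.height_le_one_of_isPrincipal_of_mem_minimalPrimes (Ideal.span {x}) Q hQ)
    (Order.one_le_iff_ne_zero.mpr fun h => hQ0 (Ideal.height_eq_zero_iff_eq_bot.mp h))
  have : (P.map (Ideal.Quotient.mk Q)).IsPrime :=
    Ideal.map_isPrime_of_surjective Ideal.Quotient.mk_surjective (by rwa [Ideal.mk_ker])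
  have hlt := height_add_one_le_of_quotient Q P hQ0 hQP
  obtain ⟨r, hr⟩ := ENat.ne_top_iff_exists.mp
    (Ideal.height_ne_top_of_isPrime (I := P.map (Ideal.Quotient.mk Q)))
  have hrn : r < n := by
    rw [← hr, ← hn] at hlt
    exact_mod_cast hlt
  have h1 := ih r hrn (P.map (Ideal.Quotient.mk Q)) inferInstance hr
  rw [ringKrullDim_eq_of_ringEquiv (DoubleQuot.quotQuotEquivQuotOfLE hQP)] at h1
  calc ringKrullDim S ≤ ringKrullDim (S ⧸ Q) + 1 := ringKrullDim_le_of_height_eq_one K Q hQ1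
    _ ≤ ((P.map (Ideal.Quotient.mk Q)).height + ringKrullDim (S ⧸ P)) + 1 := by gcongr
    _ = (((P.map (Ideal.Quotient.mk Q)).height + 1 : ℕ∞) : WithBot ℕ∞) + ringKrullDim (S ⧸ P) := by
      push_cast
      ring
    _ ≤ _ := by
      gcongr
      exact WithBot.coe_le_coe.mpr hlt

/-- A chain through a prime: `ht P + dim (S / P) ≤ dim S`. -/
theorem height_add_ringKrullDim_quotient_le {S : Type*} [CommRing S] (P : Ideal S) [P.IsPrime] :
    P.height + ringKrullDim (S ⧸ P) ≤ ringKrullDim S := by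
  have h : ringKrullDim (S ⧸ P) = Order.coheight (⟨P, inferInstance⟩ : PrimeSpectrum S) := by
    rw [ringKrullDim_quotient, Order.coheight_eq_krullDim_Ici]
    rfl
  have : Nonempty (PrimeSpectrum S) := ⟨⟨P, inferInstance⟩⟩
  rw [h, (⟨P, inferInstance⟩ : PrimeSpectrum S).height_eq_orderHeight, ← WithBot.coe_add,
    ringKrullDim, Order.krullDim_eq_iSup_height_add_coheight_of_nonempty, WithBot.coe_le_coe]
  exact le_iSup (fun x : PrimeSpectrum S => Order.height x + Order.coheight x) _

end Ideal

namespace PositiveAlgebra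

/-- The domain case is applied to `S / Q` for a minimal prime `Q` below `P`. This quotient has full
dimension by hypothesis, and heights do not decrease on pulling back to `S`. -/
theorem IsEquidimensional.ringKrullDim_le (K : Type*) {S : Type*} [Field K] [CommRing S]
    [Algebra K S] [Algebra.FiniteType K S] (hS : IsEquidimensional S) (P : Ideal S) [P.IsPrime] :
    ringKrullDim S ≤ P.height + ringKrullDim (S ⧸ P) := by
  obtain ⟨Q, hQ, hQP⟩ := Ideal.exists_minimalPrimes_le (bot_le : (⊥ : Ideal S) ≤ P)
  have : Q.IsPrime := hQ.1.1
  have : (P.map (Ideal.Quotient.mk Q)).IsPrime :=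
    Ideal.map_isPrime_of_surjective Ideal.Quotient.mk_surjective (by rwa [Ideal.mk_ker])
  have h1 := (P.map (Ideal.Quotient.mk Q)).ringKrullDim_le_height_add_quotient K
  rw [ringKrullDim_eq_of_ringEquiv (DoubleQuot.quotQuotEquivQuotOfLE hQP), hS Q hQ] at h1
  refine h1.trans ?_
  gcongr
  refine WithBot.coe_le_coe.mpr ?_
  have h2 : PrimeSpectrum.comap (Ideal.Quotient.mk Q) ⟨P.map (Ideal.Quotient.mk Q), this⟩ =
      ⟨P, inferInstance⟩ := by
    ext1
    rw [PrimeSpectrum.comap_asIdeal, Ideal.comap_map_of_surjective' _ Ideal.Quotient.mk_surjective,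
      Ideal.mk_ker, sup_eq_left.mpr hQP]
  rw [(⟨P, inferInstance⟩ : PrimeSpectrum S).height_eq_orderHeight, ← h2,
    (⟨_, this⟩ : PrimeSpectrum (S ⧸ Q)).height_eq_orderHeight]
  exact Order.height_le_height_apply_of_strictMono _
    (RingHom.strictMono_comap_of_surjective Ideal.Quotient.mk_surjective) _

end PositiveAlgebra

/-! ### Cotangent spaces under quotients and localization. -/

namespace IsLocalRing

/-- The embedding dimension of a quotient of a local ring drops by the dimension of the image of
the kernel in the cotangent space. -/
theorem finrank_span_toCotangent_add_edim {T S : Type*} [CommRing T] [CommRing S] [IsLocalRing T]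
    [IsLocalRing S] [IsNoetherianRing T] [IsNoetherianRing S] [Algebra T S]
    (hφ : Function.Surjective (algebraMap T S)) {ι : Type*} (g : ι → maximalIdeal T)
    (hg : Ideal.span (Set.range fun i => (g i : T)) = RingHom.ker (algebraMap T S)) :
    Module.finrank (ResidueField T) (Submodule.span (ResidueField T)
      (Set.range fun i => (maximalIdeal T).toCotangent (g i))) + edim S = edim T := by
  have hc : (maximalIdeal S).comap (algebraMap T S) =
      RingHom.ker (algebraMap T S) ⊔ maximalIdeal T := by
    rw [sup_eq_right.mpr (le_maximalIdeal (RingHom.ker_ne_top _))]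
    have := IsLocalHom.of_surjective (algebraMap T S) hφ
    exact (local_hom_TFAE (algebraMap T S)).out 0 4 |>.mp this
  let F := Ideal.mapCotangent (maximalIdeal T) (maximalIdeal S) (Algebra.ofId T S)
    (le_of_le_of_eq le_sup_right hc.symm)
  have hF : Function.Surjective F := Ideal.mapCotangent_surjective_of_comap_eq hφ hc
  have hFk : LinearMap.ker F = _ := Ideal.mapCotangent_ker_of_surjective hφ hc
  let N := Submodule.span (ResidueField T) (Set.range fun i => (maximalIdeal T).toCotangent (g i))
  have hN : LinearMap.ker F = N.restrictScalars T := by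
    rw [hFk, Submodule.restrictScalars_span T (ResidueField T) residue_surjective,
      Set.range_comp' (maximalIdeal T).toCotangent g, ← Submodule.map_span]
    congr 1
    apply Submodule.map_injective_of_injective (Submodule.injective_subtype (maximalIdeal T))
    rw [Submodule.map_comap_subtype, Submodule.map_span, ← Set.range_comp,
      inf_eq_right.mpr inf_le_right, inf_eq_left.mpr (le_maximalIdeal (RingHom.ker_ne_top _)), ← hg]
    rfl
  -- The two cotangent spaces live over different residue fields. Length over `T` is additive and
  -- agrees with each dimension, since all scalar maps involved are surjective.
  have hlen := Module.length_eq_add_of_exact (LinearMap.ker F).subtype F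
    (Submodule.subtype_injective _) hF (LinearMap.exact_subtype_ker_map F)
  have h1 : Module.length T (CotangentSpace T) = edim T := by
    rw [Module.length_eq_of_surjective (R := ResidueField T) (S := T) residue_surjective,
      Module.length_eq_finrank, edim]
  have h2 : Module.length T (CotangentSpace S) = edim S := by
    rw [Module.length_eq_of_surjective (R := S) (S := T) hφ,
      Module.length_eq_of_surjective (R := ResidueField S) (S := S) residue_surjective,
      Module.length_eq_finrank, edim]
  have h3 : Module.length T (LinearMap.ker F) = Module.finrank (ResidueField T) N := by
    rw [hN, ← Module.length_eq_finrank]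
    exact Module.length_eq_of_surjective (R := ResidueField T) (S := T) (M := N) residue_surjective
  rw [h1, h2, h3] at hlen
  exact_mod_cast hlen.symm

end IsLocalRing

namespace Ideal

open IsLocalRing

variable {P R : Type*} [CommRing P] [CommRing R]

/-- The map from a prime ideal to the cotangent space of the local ring at that prime. -/
def toCotangentSpace (p : Ideal P) [p.IsPrime] : p →ₗ[P] CotangentSpace (Localization.AtPrime p) :=
  (Ideal.mapCotangent p (maximalIdeal (Localization.AtPrime p)) (Algebra.ofId P _)
    (IsLocalization.AtPrime.under_maximalIdeal _ p).ge) ∘ₗ p.toCotangent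

theorem toCotangentSpace_apply (p : Ideal P) [p.IsPrime] (x : p) :
    p.toCotangentSpace x = (maximalIdeal (Localization.AtPrime p)).toCotangent
      ⟨algebraMap P _ x, (IsLocalization.AtPrime.under_maximalIdeal _ p).ge x.2⟩ :=
  rfl

theorem toCotangentSpace_eq_zero_of_mem_sq (p : Ideal P) [p.IsPrime] (x : p)
    (hx : (x : P) ∈ p ^ 2) : p.toCotangentSpace x = 0 := by
  rw [toCotangentSpace, LinearMap.comp_apply, (p.toCotangent_eq_zero x).mpr hx, map_zero]

theorem toCotangentSpace_smul (p : Ideal P) [p.IsPrime] (a : P) (x : p) :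
    p.toCotangentSpace (a • x) = algebraMap P p.ResidueField a • p.toCotangentSpace x := by
  rw [map_smul, ← algebraMap_smul (Localization.AtPrime p) a,
    ← algebraMap_smul p.ResidueField (algebraMap P (Localization.AtPrime p) a)]
  rfl

/-- The embedding dimension drops by the dimension of the image of the kernel in the cotangent
space. -/
theorem finrank_span_add_edim (f : P →+* R) (hf : Function.Surjective f) [IsNoetherianRing P]
    (p : Ideal P) (z : Ideal R) [p.IsPrime] [z.IsPrime] (h : p = z.comap f) {ι : Type*}
    (g : ι → p) (hg : Ideal.span (Set.range fun i => (g i : P)) = RingHom.ker f) :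
    Module.finrank p.ResidueField (Submodule.span p.ResidueField
      (Set.range fun i => p.toCotangentSpace (g i))) + edim (Localization.AtPrime z) =
      edim (Localization.AtPrime p) := by
  have hR : IsNoetherianRing R := isNoetherianRing_of_surjective P R f hf
  let T := Localization.AtPrime p
  let S := Localization.AtPrime z
  have hM : Submonoid.map f p.primeCompl = z.primeCompl := by
    ext x
    obtain ⟨y, rfl⟩ := hf x
    simp only [Submonoid.mem_map, Ideal.mem_primeCompl_iff, h, Ideal.mem_comap]
    exact ⟨fun ⟨w, hw, hwy⟩ => hwy ▸ hw, fun hy => ⟨y, hy, rfl⟩⟩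
  let φ : T →+* S := Localization.localRingHom p z f h
  have hφ : Function.Surjective φ := by
    have : IsLocalization (Submonoid.map f p.primeCompl) S := by
      rw [hM]; infer_instance
    exact IsLocalization.map_surjective_of_surjective p.primeCompl T S hf
  have hker : RingHom.ker φ = (RingHom.ker f).map (algebraMap P T) :=
    IsLocalization.ker_map S f hM
  let : Algebra T S := φ.toAlgebra
  refine finrank_span_toCotangent_add_edim (T := T) (S := S) hφ (fun i =>
    ⟨algebraMap P T (g i), (IsLocalization.AtPrime.under_maximalIdeal _ p).ge (g i).2⟩) ?_
  rw [RingHom.algebraMap_toAlgebra, hker, ← hg, Ideal.map_span, ← Set.range_comp]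
  rfl

/-- A denominator `s` is invertible modulo `z`: with `a s + b = 1` and `b ∈ z`, the relation `s x ∈
z²` forces `x ∈ z²`. -/
theorem toCotangentSpace_eq_zero_iff (z : Ideal R) [z.IsMaximal] (x : z) :
    z.toCotangentSpace x = 0 ↔ (x : R) ∈ z ^ 2 := by
  refine ⟨fun hx => ?_, z.toCotangentSpace_eq_zero_of_mem_sq x⟩
  rw [toCotangentSpace_apply, Ideal.toCotangent_eq_zero] at hx
  replace hx : algebraMap R (Localization.AtPrime z) x ∈
    maximalIdeal (Localization.AtPrime z) ^ 2 := hx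
  rw [← Localization.AtPrime.map_eq_maximalIdeal, ← Ideal.map_pow,
    IsLocalization.algebraMap_mem_map_algebraMap_iff z.primeCompl] at hx
  obtain ⟨s, hs, hsx⟩ := hx
  obtain ⟨a, b, hb, hab⟩ := Ideal.IsMaximal.exists_inv ‹_› hs
  have h1 : (x : R) = a * (s * x) + b * x := by
    rw [← mul_assoc, ← add_mul, hab, one_mul]
  rw [h1]
  exact add_mem (Ideal.mul_mem_left _ _ hsx) (by rw [sq]; exact Ideal.mul_mem_mul hb x.2)

theorem toCotangentSpace_surjective (z : Ideal R) [z.IsMaximal] :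
    Function.Surjective z.toCotangentSpace := by
  intro v
  obtain ⟨⟨y, hy⟩, rfl⟩ := Ideal.toCotangent_surjective _ v
  obtain ⟨x, s, rfl⟩ := IsLocalization.exists_mk'_eq z.primeCompl y
  have hx : x ∈ z := (IsLocalization.AtPrime.mk'_mem_maximal_iff _ z x s).mp hy
  obtain ⟨a, b, hb, hab⟩ := Ideal.IsMaximal.exists_inv ‹_› s.2
  -- Since `a s + b = 1`, the fraction `x / s` differs from `a x` by `b (x / s)`, a product of two
  -- elements of the maximal ideal.
  refine ⟨⟨a * x, Ideal.mul_mem_left _ _ hx⟩, ?_⟩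
  rw [toCotangentSpace_apply, Ideal.toCotangent_eq]
  have h1 : algebraMap R (Localization.AtPrime z) (a * x) - IsLocalization.mk' _ x s =
      -(algebraMap R _ b * IsLocalization.mk' _ x s) := by
    have h2 := IsLocalization.mk'_spec' (Localization.AtPrime z) x s
    have h3 := congrArg (algebraMap R (Localization.AtPrime z)) hab
    rw [map_add, map_mul, map_one] at h3
    rw [map_mul, ← h2]
    linear_combination (IsLocalization.mk' (Localization.AtPrime z) x s) * h3
  rw [h1, neg_mem_iff, sq]
  exact Ideal.mul_mem_mul ((IsLocalization.AtPrime.under_maximalIdeal _ z).ge hb) hy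

/-- The cotangent space of a maximal ideal with residue field `K` has the embedding dimension of
the local ring as its dimension over `K`. -/
theorem finrank_cotangent_eq_edim {K : Type*} [Field K] [Algebra K R] (z : Ideal R)
    [z.IsMaximal] (hz : ∀ r : R, ∃ c : K, r - algebraMap K R c ∈ z) :
    Module.finrank K z.Cotangent = edim (Localization.AtPrime z) := by
  let F : z.Cotangent →ₗ[R] CotangentSpace (Localization.AtPrime z) :=
    Ideal.mapCotangent z (maximalIdeal (Localization.AtPrime z)) (Algebra.ofId R _)
      (IsLocalization.AtPrime.under_maximalIdeal _ z).ge
  have hFt (x : z) : F (z.toCotangent x) = z.toCotangentSpace x := rfl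
  have hF : Function.Bijective F := by
    constructor
    · rw [injective_iff_map_eq_zero]
      intro v hv
      obtain ⟨x, rfl⟩ := z.toCotangent_surjective v
      rw [Ideal.toCotangent_eq_zero, ← toCotangentSpace_eq_zero_iff, ← hFt, hv]
    · intro w
      obtain ⟨x, rfl⟩ := z.toCotangentSpace_surjective w
      exact ⟨z.toCotangent x, hFt x⟩
  let j : z.Cotangent ≃+ CotangentSpace (Localization.AtPrime z) :=
    AddEquiv.ofBijective F.toAddMonoidHom hF
  let i : K →+* z.ResidueField := (algebraMap R z.ResidueField).comp (algebraMap K R)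
  have hi : Function.Bijective i := by
    refine ⟨i.injective, fun y => ?_⟩
    obtain ⟨r, rfl⟩ := z.algebraMap_residueField_surjective y
    obtain ⟨c, hc⟩ := hz r
    refine ⟨c, ?_⟩
    rw [← Ideal.algebraMap_residueField_eq_zero, map_sub, sub_eq_zero] at hc
    exact hc.symm
  have hij (c : K) (v : z.Cotangent) : j (c • v) = i c • j v := by
    obtain ⟨x, rfl⟩ := z.toCotangent_surjective v
    rw [← algebraMap_smul R c, ← map_smul]
    exact z.toCotangentSpace_smul _ x
  have h := congrArg Cardinal.toNat (lift_rank_eq_of_equiv_equiv i j hi hij)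
  rwa [Cardinal.toNat_lift, Cardinal.toNat_lift] at h

end Ideal

theorem ringKrullDim_quotient_comap_of_surjective {R S : Type*} [CommRing R] [CommRing S]
    (f : R →+* S) (hf : Function.Surjective f) (z : Ideal S) :
    ringKrullDim (R ⧸ z.comap f) = ringKrullDim (S ⧸ z) := by
  have h : RingHom.ker ((Ideal.Quotient.mk z).comp f) = z.comap f := by
    rw [← RingHom.comap_ker, Ideal.mk_ker]
  rw [← h]
  exact ringKrullDim_eq_of_ringEquiv
    (RingHom.quotientKerEquivOfSurjective (Ideal.Quotient.mk_surjective.comp hf))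

theorem exists_ringKrullDim_eq_natCast {S : Type*} [CommRing S] [Nontrivial S] {n : ℕ}
    (h : ringKrullDim S ≤ n) : ∃ c : ℕ, ringKrullDim S = c := by
  obtain ⟨c, hc⟩ := WithBot.ne_bot_iff_exists.mp
    (((WithBot.bot_lt_coe 0).trans_le (ringKrullDim_nonneg_of_nontrivial (R := S))).ne')
  rw [← hc] at h ⊢
  have hc' : c ≤ (n : ℕ∞) := WithBot.coe_le_coe.mp h
  obtain ⟨c', rfl⟩ := ENat.ne_top_iff_exists.mp (ne_top_of_le_ne_top (ENat.natCast_ne_top n) hc')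
  exact ⟨c', rfl⟩

/-! ### The polynomial ring along its zero section. -/

namespace MvPolynomial

theorem ker_constantCoeff_eq_idealOfVars (σ A : Type*) [CommRing A] :
    RingHom.ker (constantCoeff : MvPolynomial σ A →+* A) = idealOfVars σ A := by
  ext f
  rw [← pow_one (idealOfVars σ A), mem_pow_idealOfVars_iff', RingHom.mem_ker, constantCoeff_eq]
  refine ⟨fun h x hx => ?_, fun h => h 0 (by simp)⟩
  rw [Nat.lt_one_iff, Finsupp.degree_eq_zero_iff] at hx
  rw [hx, h]

/-- A polynomial without constant term agrees with its linear part modulo the square of the ideal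
of the variables. -/
theorem sub_linear_mem_idealOfVars_sq {σ A : Type*} [CommRing A] [Fintype σ]
    (f : MvPolynomial σ A) (hf : constantCoeff f = 0) :
    f - ∑ j, C (coeff (Finsupp.single j 1) f) * X j ∈ idealOfVars σ A ^ 2 := by
  classical
  rw [mem_pow_idealOfVars_iff']
  intro x hx
  rw [coeff_sub, coeff_sum, sub_eq_zero]
  simp_rw [coeff_C_mul, coeff_X]
  rcases Nat.lt_succ_iff_lt_or_eq.mp hx with h | h
  · rw [Nat.lt_one_iff, Finsupp.degree_eq_zero_iff] at h
    subst h
    rw [← constantCoeff_eq, hf]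
    simp
  · obtain ⟨i, rfl⟩ := (Set.ext_iff.mp Finsupp.range_single_one x).mpr h
    simp [Finsupp.single_left_inj]

end MvPolynomial

namespace PositiveAlgebra

variable {K : Type*} [Field K] {m k : ℕ}

theorem edim_localization_of_isRegularRing {S : Type*} [CommRing S] [IsRegularRing S]
    (p : Ideal S) [p.IsPrime] : (edim (Localization.AtPrime p) : ℕ∞) = p.height := by
  have h := (IsRegularLocalRing.iff_finrank_cotangentSpace (Localization.AtPrime p)).mp inferInstance
  rw [IsLocalization.AtPrime.ringKrullDim_eq_height p] at h
  exact WithBot.coe_injective h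

/-- The prime of the polynomial ring over a prime `p` of `A` on the zero section. -/
def zeroPrime (k : ℕ) (p : Ideal (MvPolynomial (Fin m) K)) : Ideal (PolyRing K m k) :=
  p.comap constantCoeff

instance (p : Ideal (MvPolynomial (Fin m) K)) [p.IsPrime] : (zeroPrime k p).IsPrime :=
  inferInstanceAs (p.comap constantCoeff).IsPrime

theorem constantCoeff_surjective :
    Function.Surjective (constantCoeff : PolyRing K m k →+* MvPolynomial (Fin m) K) :=
  fun a => ⟨C a, constantCoeff_C _ a⟩

theorem ringKrullDim_polyRing : ringKrullDim (PolyRing K m k) = ((m + k : ℕ) : WithBot ℕ∞) := by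
  simp [PolyRing, ringKrullDim_eq_zero_of_field]

theorem ringKrullDim_base : ringKrullDim (MvPolynomial (Fin m) K) = (m : WithBot ℕ∞) := by
  simp [ringKrullDim_eq_zero_of_field]

/-- Both primes have the same quotient `A / p`; the dimension inequality for `P` is compared with
the chain inequality for `A`. -/
theorem height_add_le_height_zeroPrime (p : Ideal (MvPolynomial (Fin m) K)) [p.IsPrime] :
    p.height + k ≤ (zeroPrime k p).height := by
  have h1 := (zeroPrime k p).ringKrullDim_le_height_add_quotient K
  have h2 := p.height_add_ringKrullDim_quotient_le
  rw [zeroPrime, ringKrullDim_quotient_comap_of_surjective _ constantCoeff_surjective,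
    ringKrullDim_polyRing] at h1
  rw [ringKrullDim_base] at h2
  obtain ⟨a, ha⟩ := ENat.ne_top_iff_exists.mp (Ideal.height_ne_top_of_isPrime (I := p))
  obtain ⟨b, hb⟩ := ENat.ne_top_iff_exists.mp
    (Ideal.height_ne_top_of_isPrime (I := zeroPrime k p))
  obtain ⟨c, hc⟩ := exists_ringKrullDim_eq_natCast
    ((ringKrullDim_quotient_le p).trans ringKrullDim_base.le)
  rw [zeroPrime] at hb
  rw [hc, ← hb] at h1
  rw [hc, ← ha] at h2
  rw [zeroPrime, ← ha, ← hb]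
  norm_cast at h1 h2 ⊢
  omega

/-- The variable `x_j` as an element of the prime `zeroPrime k p`. -/
def zeroPrimeVar (p : Ideal (MvPolynomial (Fin m) K)) (j : Fin k) : zeroPrime k p :=
  ⟨X j, by simp [zeroPrime]⟩

theorem finrank_span_vars_add (p : Ideal (MvPolynomial (Fin m) K)) [p.IsPrime] :
    Module.finrank (zeroPrime k p).ResidueField (Submodule.span (zeroPrime k p).ResidueField
      (Set.range fun j => (zeroPrime k p).toCotangentSpace (zeroPrimeVar p j))) +
      edim (Localization.AtPrime p) = edim (Localization.AtPrime (zeroPrime k p)) :=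
  (zeroPrime k p).finrank_span_add_edim constantCoeff constantCoeff_surjective p rfl
    (zeroPrimeVar p) (ker_constantCoeff_eq_idealOfVars _ _).symm

/-- By regularity of `A` and `P`, the height gap is a gap of embedding dimensions, so the `k`
variables span a space of dimension at least `k`. -/
theorem linearIndependent_vars (p : Ideal (MvPolynomial (Fin m) K)) [p.IsPrime] :
    LinearIndependent (zeroPrime k p).ResidueField
      (fun j => (zeroPrime k p).toCotangentSpace (zeroPrimeVar p j)) := by
  have h1 := finrank_span_vars_add (k := k) p
  have h2 := height_add_le_height_zeroPrime (k := k) p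
  rw [← edim_localization_of_isRegularRing, ← edim_localization_of_isRegularRing] at h2
  have h3 : edim (Localization.AtPrime p) + k ≤ edim (Localization.AtPrime (zeroPrime k p)) := by
    exact_mod_cast h2
  rw [linearIndependent_iff_card_le_finrank_span, Fintype.card_fin, Set.finrank]
  omega

theorem edim_zeroPrime (p : Ideal (MvPolynomial (Fin m) K)) [p.IsPrime] :
    edim (Localization.AtPrime (zeroPrime k p)) = k + edim (Localization.AtPrime p) := by
  rw [← finrank_span_vars_add, finrank_span_eq_card (linearIndependent_vars p), Fintype.card_fin]

/-- The matrix of linear coefficients computes the embedding dimension on the zero section. -/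
theorem edim_add_rank {s : ℕ} {I : Ideal (PolyRing K m k)} (G : Fin s → PolyRing K m k)
    (hG : Ideal.span (Set.range G) = I) (hG0 : ∀ i, constantCoeff (G i) = 0)
    (p : Ideal (MvPolynomial (Fin m) K)) [p.IsPrime] (z : Ideal (PolyRing K m k ⧸ I)) [z.IsPrime]
    (hz : zeroPrime k p = z.comap (Ideal.Quotient.mk I)) {L : Type*} [Field L]
    (φ : MvPolynomial (Fin m) K →+* L) (hφ : RingHom.ker φ = p) :
    (edim (Localization.AtPrime z) + ((linCoeffMatrix G).map φ).rank : ℕ∞) = p.height + k := by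
  set κ := (zeroPrime k p).ResidueField
  -- The rank depends only on the kernel of the map to a field, so the residue field `κ` may replace
  -- `L`.
  let ψ : MvPolynomial (Fin m) K →+* κ := (algebraMap (PolyRing K m k) κ).comp C
  have hψ : RingHom.ker ψ = p := by
    ext a
    rw [RingHom.mem_ker, RingHom.comp_apply, Ideal.algebraMap_residueField_eq_zero, zeroPrime,
      Ideal.mem_comap, constantCoeff_C]
  have hrank : ((linCoeffMatrix G).map φ).rank = ((linCoeffMatrix G).map ψ).rank :=
    le_antisymm (Matrix.rank_map_le_of_ker_le _ _ (hψ.trans hφ.symm).le _)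
      (Matrix.rank_map_le_of_ker_le _ _ (hφ.trans hψ.symm).le _)
  have hmem (i : Fin s) : G i ∈ zeroPrime k p := by
    rw [zeroPrime, Ideal.mem_comap, hG0]
    exact p.zero_mem
  let g : Fin s → zeroPrime k p := fun i => ⟨G i, hmem i⟩
  have hg := (zeroPrime k p).finrank_span_add_edim (Ideal.Quotient.mk I)
    Ideal.Quotient.mk_surjective z hz g (by rw [Ideal.mk_ker, ← hG])
  let e := Fintype.linearCombination κ
    (fun j => (zeroPrime k p).toCotangentSpace (zeroPrimeVar p j))
  have he : Function.Injective e :=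
    linearIndependent_iff_injective_fintypeLinearCombination.mp (linearIndependent_vars p)
  have hrow (i : Fin s) :
      (zeroPrime k p).toCotangentSpace (g i) = e (((linCoeffMatrix G).map ψ).row i) := by
    have h1 : (zeroPrime k p).toCotangentSpace (g i - ∑ j,
        (C (coeff (Finsupp.single j 1) (G i)) : PolyRing K m k) • zeroPrimeVar p j) = 0 := by
      apply Ideal.toCotangentSpace_eq_zero_of_mem_sq
      have h2 := sub_linear_mem_idealOfVars_sq (G i) (hG0 i)
      rw [← ker_constantCoeff_eq_idealOfVars] at h2
      have h3 := Ideal.pow_right_mono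
        (Ideal.comap_mono (f := (constantCoeff : PolyRing K m k →+* _)) (bot_le : ⊥ ≤ p)) 2 h2
      have h4 : ((g i - ∑ j, (C (coeff (Finsupp.single j 1) (G i)) : PolyRing K m k) •
          zeroPrimeVar p j : zeroPrime k p) : PolyRing K m k) =
          G i - ∑ j, C (coeff (Finsupp.single j 1) (G i)) * X j := by
        simp [g, zeroPrimeVar]
      rw [h4]
      exact h3
    rw [map_sub, sub_eq_zero, map_sum] at h1
    simp_rw [Ideal.toCotangentSpace_smul] at h1
    rw [h1, Fintype.linearCombination_apply]
    rfl
  have hspan : Module.finrank κ (Submodule.span κ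
      (Set.range fun i => (zeroPrime k p).toCotangentSpace (g i))) =
      ((linCoeffMatrix G).map ψ).rank := by
    -- The classes of the generators are the rows of the matrix, written in the independent
    -- variables.
    rw [funext hrow, Set.range_comp' e, ← Submodule.map_span, Matrix.rank_eq_finrank_span_row]
    exact (Submodule.equivMapOfInjective e he _).finrank_eq.symm
  rw [hspan, edim_zeroPrime] at hg
  rw [hrank, ← edim_localization_of_isRegularRing p]
  norm_cast
  omega

/-- Primes of a Noetherian ring have finite height, so neither default value in `krullDim` occurs.
-/
theorem krullDim_localization {S : Type*} [CommRing S] [IsNoetherianRing S] (z : Ideal S)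
    [z.IsPrime] : (krullDim (Localization.AtPrime z) : ℕ∞) = z.height := by
  rw [krullDim, IsLocalization.AtPrime.ringKrullDim_eq_height z, WithBot.unbotD_coe]
  exact ENat.natCast_toNat Ideal.height_ne_top_of_isPrime

theorem krullDim_localization_le_edim {S : Type*} [CommRing S] [IsNoetherianRing S] (z : Ideal S)
    [z.IsPrime] : krullDim (Localization.AtPrime z) ≤ edim (Localization.AtPrime z) := by
  have h := ringKrullDim_le_spanFinrank_maximalIdeal (Localization.AtPrime z)
  rw [IsLocalization.AtPrime.ringKrullDim_eq_height z, ← krullDim_localization,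
    IsLocalRing.spanFinrank_maximalIdeal_eq_finrank_cotangentSpace] at h
  exact_mod_cast h

theorem isRegularLocalRing_localization_iff {S : Type*} [CommRing S] [IsNoetherianRing S]
    (z : Ideal S) [z.IsPrime] : IsRegularLocalRing (Localization.AtPrime z) ↔
      edim (Localization.AtPrime z) = krullDim (Localization.AtPrime z) := by
  rw [IsRegularLocalRing.iff_finrank_cotangentSpace,
    IsLocalization.AtPrime.ringKrullDim_eq_height z, ← krullDim_localization]
  norm_cast

end PositiveAlgebra

/-! ### The zero section of `Spec R`. -/

namespace PositiveAlgebra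

variable {K : Type*} [Field K] {m k : ℕ} {W : Fin k → ℤ} {I : Ideal (PolyRing K m k)}

theorem zeroSectionHom_surjective (h : IsPositiveAlgebra W I) :
    Function.Surjective (zeroSectionHom h) := fun a =>
  ⟨Ideal.Quotient.mk I (C a), by rw [zeroSectionHom, Ideal.Quotient.lift_mk, constantCoeff_C]⟩

theorem zeroPrime_eq_comap (h : IsPositiveAlgebra W I) (p : Ideal (MvPolynomial (Fin m) K)) :
    zeroPrime k p = (p.comap (zeroSectionHom h)).comap (Ideal.Quotient.mk I) := by
  rw [Ideal.comap_comap]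
  rfl

/-- The kernel of evaluation at `Γ` pulls back to the zero point over `Γ`. -/
theorem zeroPoint_asIdeal (h : IsPositiveAlgebra W I) (Γ : Fin m → K) :
    (zeroPoint h Γ).asIdeal = (RingHom.ker (eval Γ)).comap (zeroSectionHom h) := by
  have h1 : evalZeroPoint (k := k) Γ = (eval Γ).comp constantCoeff := by
    ext <;> simp [evalZeroPoint]
  apply Ideal.comap_injective_of_surjective _ (Ideal.Quotient.mk_surjective (I := I))
  rw [← zeroPrime_eq_comap, zeroPrime, RingHom.comap_ker, ← h1]
  change Ideal.comap _ (Ideal.map _ _) = _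
  rw [Ideal.comap_map_of_surjective' _ Ideal.Quotient.mk_surjective, Ideal.mk_ker,
    sup_eq_left.mpr (h.le_zeroMaxIdeal Γ), zeroMaxIdeal]

theorem eval_surjective (Γ : Fin m → K) : Function.Surjective (eval Γ) :=
  fun c => ⟨C c, eval_C c⟩

theorem zeroPoint_isMaximal (h : IsPositiveAlgebra W I) (Γ : Fin m → K) :
    (zeroPoint h Γ).asIdeal.IsMaximal := by
  rw [zeroPoint_asIdeal]
  have : (RingHom.ker (eval Γ)).IsMaximal := RingHom.ker_isMaximal_of_surjective _ (eval_surjective Γ)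
  exact Ideal.comap_isMaximal_of_surjective _ (zeroSectionHom_surjective h)

theorem finrank_cotangent_zeroPoint (h : IsPositiveAlgebra W I) (Γ : Fin m → K) :
    Module.finrank K (zeroPoint h Γ).asIdeal.Cotangent = edim (ZeroLocalRing h Γ) := by
  have := zeroPoint_isMaximal h Γ
  refine Ideal.finrank_cotangent_eq_edim _ fun r => ?_
  refine ⟨eval Γ (zeroSectionHom h r), ?_⟩
  rw [zeroPoint_asIdeal, Ideal.mem_comap, RingHom.mem_ker, map_sub, map_sub, sub_eq_zero]
  have h2 (c : K) : zeroSectionHom h (algebraMap K _ c) = C c := by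
    change zeroSectionHom h (Ideal.Quotient.mk I (algebraMap K (PolyRing K m k) c)) = _
    rw [zeroSectionHom, Ideal.Quotient.lift_mk, IsScalarTower.algebraMap_apply K (MvPolynomial (Fin m) K),
      MvPolynomial.algebraMap_eq, constantCoeff_C]
    rfl
  rw [h2, eval_C]

theorem height_ker_eval (Γ : Fin m → K) : (RingHom.ker (eval Γ)).height = m := by
  have : (RingHom.ker (eval Γ)).IsMaximal := RingHom.ker_isMaximal_of_surjective _ (eval_surjective Γ)
  exact Ideal.height_eq_of_isMaximal_mvPolynomial K m _

variable {s : ℕ} {G : Fin s → PolyRing K m k}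

theorem constantCoeff_generator (h : IsPositiveAlgebra W I) (hG : Ideal.span (Set.range G) = I)
    (i : Fin s) : constantCoeff (G i) = 0 :=
  h.constantCoeff_eq_zero (hG ▸ Ideal.subset_span ⟨i, rfl⟩)

theorem edim_zeroLocalRing_add_rank (h : IsPositiveAlgebra W I)
    (hG : Ideal.span (Set.range G) = I) (Γ : Fin m → K) :
    edim (ZeroLocalRing h Γ) + (linCoeffMatrixAt G Γ).rank = m + k := by
  have : (RingHom.ker (eval Γ)).IsPrime := RingHom.ker_isPrime _
  have h1 := edim_add_rank G hG (constantCoeff_generator h hG) (RingHom.ker (eval Γ))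
    (zeroPoint h Γ).asIdeal (by rw [zeroPoint_asIdeal, ← zeroPrime_eq_comap]) (eval Γ) rfl
  rw [height_ker_eval] at h1
  exact_mod_cast h1

theorem edim_comap_add_rank (h : IsPositiveAlgebra W I) (hG : Ideal.span (Set.range G) = I)
    (p : Ideal (MvPolynomial (Fin m) K)) [p.IsPrime] {L : Type*} [Field L]
    (φ : MvPolynomial (Fin m) K →+* L) (hφ : RingHom.ker φ = p) :
    (edim (Localization.AtPrime (p.comap (zeroSectionHom h))) +
      ((linCoeffMatrix G).map φ).rank : ℕ∞) = p.height + k :=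
  edim_add_rank G hG (constantCoeff_generator h hG) p _ (zeroPrime_eq_comap h p) φ hφ

theorem ringKrullDim_quotient_comap_zeroSectionHom (h : IsPositiveAlgebra W I)
    (p : Ideal (MvPolynomial (Fin m) K)) :
    ringKrullDim ((PolyRing K m k ⧸ I) ⧸ p.comap (zeroSectionHom h)) =
      ringKrullDim (MvPolynomial (Fin m) K ⧸ p) :=
  ringKrullDim_quotient_comap_of_surjective _ (zeroSectionHom_surjective h) p

/-- The zero section has no regular point when the generic rank is small. -/
theorem zeroSection_subset_singularLocus (h : IsPositiveAlgebra W I)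
    (hG : Ideal.span (Set.range G) = I) {d : ℕ} (hd : ringKrullDim (PolyRing K m k ⧸ I) = d)
    (hlt : (linCoeffMatrix G).rank + d < m + k) :
    zeroSection h ⊆ singularLocus (PolyRing K m k ⧸ I) := by
  rintro _ ⟨⟨p, hp⟩, rfl⟩ hreg
  change IsRegularLocalRing (Localization.AtPrime (p.comap (zeroSectionHom h))) at hreg
  rw [isRegularLocalRing_localization_iff] at hreg
  have h1 := edim_comap_add_rank h hG p (algebraMap _ p.ResidueField) p.ker_algebraMap_residueField
  have h2 := (p.comap (zeroSectionHom h)).height_add_ringKrullDim_quotient_le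
  have h3 := p.ringKrullDim_le_height_add_quotient K
  have h4 := (linCoeffMatrix G).rank_map_le_rank (algebraMap _ p.ResidueField)
  -- Put `c = dim A/p`. The embedding dimension is at least `m + k - c - rank`, which exceeds `d -
  -- c`, while the local dimension is at most `d - c`.
  obtain ⟨a, ha⟩ := ENat.ne_top_iff_exists.mp (Ideal.height_ne_top_of_isPrime (I := p))
  obtain ⟨c, hc⟩ := exists_ringKrullDim_eq_natCast
    ((ringKrullDim_quotient_le p).trans ringKrullDim_base.le)
  rw [ringKrullDim_quotient_comap_zeroSectionHom, hc, hd, ← krullDim_localization] at h2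
  rw [ringKrullDim_base, hc, ← ha] at h3
  rw [← ha] at h1
  norm_cast at h1 h2 h3
  omega

theorem krullDim_zeroLocalRing_le (h : IsPositiveAlgebra W I) {d : ℕ}
    (hd : ringKrullDim (PolyRing K m k ⧸ I) = d) (Γ : Fin m → K) :
    krullDim (ZeroLocalRing h Γ) ≤ d := by
  have h1 := Ideal.height_le_ringKrullDim_of_isPrime (I := (zeroPoint h Γ).asIdeal)
  rw [hd, ← krullDim_localization] at h1
  exact_mod_cast h1

theorem IsEquidimensional.krullDim_zeroLocalRing (h : IsPositiveAlgebra W I) {d : ℕ}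
    (hd : ringKrullDim (PolyRing K m k ⧸ I) = d) (hE : IsEquidimensional (PolyRing K m k ⧸ I))
    (Γ : Fin m → K) : krullDim (ZeroLocalRing h Γ) = d := by
  refine (krullDim_zeroLocalRing_le h hd Γ).antisymm ?_
  have := zeroPoint_isMaximal h Γ
  let := Ideal.Quotient.field (zeroPoint h Γ).asIdeal
  have h1 := hE.ringKrullDim_le K (zeroPoint h Γ).asIdeal
  rw [ringKrullDim_eq_zero_of_field, add_zero, hd, ← krullDim_localization] at h1
  exact_mod_cast h1

/-- At the generic point of the zero section the embedding dimension is `k - rank`, and the local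
dimension is at least `d - m`. -/
theorem IsEquidimensional.rank_linCoeffMatrix_le (h : IsPositiveAlgebra W I)
    (hG : Ideal.span (Set.range G) = I) {d : ℕ} (hd : ringKrullDim (PolyRing K m k ⧸ I) = d)
    (hE : IsEquidimensional (PolyRing K m k ⧸ I)) :
    (linCoeffMatrix G).rank + d ≤ m + k := by
  let A := MvPolynomial (Fin m) K
  have hφ : RingHom.ker (algebraMap A (FractionRing A)) = ⊥ :=
    (RingHom.injective_iff_ker_eq_bot _).mp (IsFractionRing.injective A (FractionRing A))
  have h1 := edim_comap_add_rank h hG (⊥ : Ideal A) _ hφ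
  have h2 := hE.ringKrullDim_le K ((⊥ : Ideal A).comap (zeroSectionHom h))
  have h3 := krullDim_localization_le_edim ((⊥ : Ideal A).comap (zeroSectionHom h))
  rw [ringKrullDim_quotient_comap_zeroSectionHom, ringKrullDim_eq_of_ringEquiv
    (RingEquiv.quotientBot A), ringKrullDim_base, hd, ← krullDim_localization] at h2
  rw [Matrix.rank_map_algebraMap_fractionRing, Ideal.height_bot] at h1
  norm_cast at h1 h2
  omega

end PositiveAlgebra

end

theorem mainTheorem1 {K : Type*} [Field K] (m k s d : ℕ) (W : Fin k → ℤ)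
    (I : Ideal (PolyRing K m k)) (hI : IsPositiveAlgebra W I)
    (hd : ringKrullDim (PolyRing K m k ⧸ I) = d)
    (G : Fin s → PolyRing K m k)
    (hGhom : ∀ i, ∃ e : ℤ, IsWeightedHomogeneous W (G i) e)
    (hGspan : Ideal.span (Set.range G) = I) :
    -- (a)
    (∀ Γ : Fin m → K,
      ((linCoeffMatrixAt G Γ).rank : ℤ) =
          ((m + k : ℕ) : ℤ) - Module.finrank K (zeroPoint hI Γ).asIdeal.Cotangent ∧
        ((linCoeffMatrixAt G Γ).rank : ℤ) ≤
          ((m + k : ℕ) : ℤ) - krullDim (ZeroLocalRing hI Γ)) ∧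
    -- (b)
    singZero hI =
      {Γ : Fin m → K | ((linCoeffMatrixAt G Γ).rank : ℤ) <
        ((m + k : ℕ) : ℤ) - krullDim (ZeroLocalRing hI Γ)} ∧
    -- (c)
    (((linCoeffMatrix G).rank : ℤ) < ((m + k : ℕ) : ℤ) - d →
      singZero hI = Set.univ ∧
        zeroSection hI ⊆ singularLocus (PolyRing K m k ⧸ I)) ∧
    -- (d)
    (((linCoeffMatrix G).rank : ℤ) = ((m + k : ℕ) : ℤ) - d →
      zeroLocus K (minorsIdeal (linCoeffMatrix G) (m + k - d)) ⊆ singZero hI) ∧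
    -- (e)
    (IsEquidimensional (PolyRing K m k ⧸ I) →
      ((linCoeffMatrix G).rank : ℤ) ≤ ((m + k : ℕ) : ℤ) - d ∧
        singZero hI = zeroLocus K (minorsIdeal (linCoeffMatrix G) (m + k - d))) := by
  have hedim := edim_zeroLocalRing_add_rank hI hGspan
  have hb : singZero hI = {Γ : Fin m → K | ((linCoeffMatrixAt G Γ).rank : ℤ) <
      ((m + k : ℕ) : ℤ) - krullDim (ZeroLocalRing hI Γ)} := by
    ext Γ
    have := hedim Γ
    rw [singZero, Set.mem_ofPred_eq, Set.mem_ofPred_eq, ecod]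
    omega
  refine ⟨fun Γ => ?_, hb, fun hlt => ⟨?_, ?_⟩, fun hr Γ hΓ => ?_, fun hE => ⟨?_, ?_⟩⟩
  · have h1 := hedim Γ
    have h2 : krullDim (ZeroLocalRing hI Γ) ≤ edim (ZeroLocalRing hI Γ) :=
      krullDim_localization_le_edim _
    rw [finrank_cotangent_zeroPoint]
    omega
  · rw [hb, Set.eq_univ_iff_forall]
    intro Γ
    have h1 := krullDim_zeroLocalRing_le hI hd Γ
    have h2 : (linCoeffMatrixAt G Γ).rank ≤ (linCoeffMatrix G).rank :=
      Matrix.rank_map_le_rank (eval Γ) _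
    rw [Set.mem_ofPred_eq]
    omega
  · exact zeroSection_subset_singularLocus hI hGspan hd (by omega)
  · have h1 := krullDim_zeroLocalRing_le hI hd Γ
    have h2 : (linCoeffMatrixAt G Γ).rank < m + k - d := (mem_zeroLocus_minorsIdeal _ Γ).mp hΓ
    rw [hb, Set.mem_ofPred_eq]
    omega
  · have := hE.rank_linCoeffMatrix_le hI hGspan hd
    omega
  · rw [hb]
    ext Γ
    have h1 := hE.krullDim_zeroLocalRing hI hd Γ
    have h2 := hE.rank_linCoeffMatrix_le hI hGspan hd
    rw [mem_zeroLocus_minorsIdeal, Set.mem_ofPred_eq, h1]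
    -- Truncation in `m + k - d` is harmless: a rank is never negative, so both inequalities would
    -- fail for `d > m + k`.
    change ((linCoeffMatrixAt G Γ).rank : ℤ) < _ ↔ (linCoeffMatrixAt G Γ).rank < _
    omega
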